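/- For a slope $s\in(1,2]$ let $T=T_s:[0,1]\to[0,1]$, $T_s(x)=\min\{sx,\,s(1-x)\}$, be the tent map, with critical point $c=\tfrac12$, and write $c_n=T^n(c)$; the interval $[c_2,c_1]$ is the core. Put $D_1=[c,c_1]$ and, for $n\ge 1$, $D_{n+1}=[c_{n+1},c_1]$ if $c\in D_n$ and $D_{n+1}=T(D_n)$ if $c\notin D_n$. An integer $n\ge1$ is a cutting time if $c\in D_n$; the cutting times are numbered increasingly $1=S_0<S_1<S_2<\cdots$. Let $\mathcal A$ be the Barge–Brucks–Diamond set: the set of all $s\in[\sqrt2,2]$ such that for every $a\in[c_2,c]$ and every $\delta>0$ there exist an integer $n\ge1$ and points $c_2<a_s<b_s<c_1$ with $T_s^n(c_2)\in(a-\delta,a+\delta)$, $T_s^n(a_s)=c_2$, $T_s^n(b_s)=c$, and $T_s^n$ monotone on each of the intervals $[c_2,a_s]$ and $[a_s,b_s]$. **Proposition.** For every $s\in(1,2]$, the set $\{c_{S_k}: k\ge 1\}$ is dense in the core $[c_2,c_1]$ if and only if $s\in\mathcal A$. -/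

import Mathlib

namespace TentMap

/-- The tent map `T_s(x) = min {s x, s (1 - x)}` of slope `s`. It is used for `1 < s ≤ 2`, when it
maps `[0, 1]` into itself; all the points occurring below lie in `[0, 1]`. -/
noncomputable def tent (s x : ℝ) : ℝ := min (s * x) (s * (1 - x))

/-- The critical point `c = 1/2`. -/
noncomputable def crit : ℝ := 1 / 2

/-- The critical orbit `c_n = T_s^n(c)`. -/
noncomputable def critOrbit (s : ℝ) (n : ℕ) : ℝ := (tent s)^[n] crit

/-- The core `[c_2, c_1]`. -/
def core (s : ℝ) : Set ℝ := Set.Icc (critOrbit s 2) (critOrbit s 1)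

open Classical in
/-- The intervals of the Hofbauer tower: `D_1 = [c, c_1]`, and `D_{n+1}` is `[c_{n+1}, c_1]` if
`c ∈ D_n` and `T_s(D_n)` otherwise, for `n ≥ 1`. (The index `0` is not used; `D_0` is set to `∅`,
so that `0` is not a cutting time.) -/
noncomputable def hofbauer (s : ℝ) : ℕ → Set ℝ
  | 0 => ∅
  | 1 => Set.Icc crit (critOrbit s 1)
  | n + 2 =>
    if crit ∈ hofbauer s (n + 1) then Set.Icc (critOrbit s (n + 2)) (critOrbit s 1)
    else tent s '' hofbauer s (n + 1)

/-- `n` is a cutting time if `c ∈ D_n`. -/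
def IsCuttingTime (s : ℝ) (n : ℕ) : Prop := crit ∈ hofbauer s n

/-- The increasing enumeration `S_0 = 1 < S_1 = 2 < S_2 < ⋯` of the cutting times. -/
noncomputable def cuttingTime (s : ℝ) (k : ℕ) : ℕ := Nat.nth (IsCuttingTime s) k

/-- `f` is monotone (nondecreasing or nonincreasing) on the set `J`. -/
def IsMonotoneOn (f : ℝ → ℝ) (J : Set ℝ) : Prop := MonotoneOn f J ∨ AntitoneOn f J

/-- The Barge–Brucks–Diamond set `𝒜` of slopes, a subset of the parameter interval `[√2, 2]`:
for all `a ∈ [c_2, c]` and `δ > 0` there are `n ≥ 1` and `c_2 < u < v < c_1` such that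
`T_s^n(c_2) ∈ (a - δ, a + δ)`, `T_s^n(u) = c_2`, `T_s^n(v) = c`, and `T_s^n` is monotone on
`[c_2, u]` and on `[u, v]`. -/
def bargeBrucksDiamond : Set ℝ :=
  {s | s ∈ Set.Icc (Real.sqrt 2) 2 ∧
    ∀ a ∈ Set.Icc (critOrbit s 2) crit, ∀ δ : ℝ, 0 < δ →
      ∃ n : ℕ, 1 ≤ n ∧ ∃ u v : ℝ,
        critOrbit s 2 < u ∧ u < v ∧ v < critOrbit s 1 ∧
        (tent s)^[n] (critOrbit s 2) ∈ Set.Ioo (a - δ) (a + δ) ∧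
        (tent s)^[n] u = critOrbit s 2 ∧
        (tent s)^[n] v = crit ∧
        IsMonotoneOn (tent s)^[n] (Set.Icc (critOrbit s 2) u) ∧
        IsMonotoneOn (tent s)^[n] (Set.Icc u v)}

end TentMap

/-!
Call `c = 1/2`, `c_n = T^n(c)`, and let `p` be the fixed point of `T` to the right of `c`. The level
`D_{n+2}` of the tower is `T^n([c_2, z])` for the largest interval `[c_2, z]` in the core on which
`T^n` is injective. So if `c` is not periodic, `n + 2` is a cutting time exactly when `T^n z = c`
for some `[c_2, z]` on which `T^n` is injective.

Density implies `s ∈ 𝒜`: write `R` for the inverse of the right-hand branch. Near `R^4(b)`, with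
`b` near `a`, there is some `c_n` with `n` a cutting time. The iterates `c_n, …, c_{n+3}` stay to
the right of `c` and `c_{n+4}` is near `a`. Now `T^{n-2}` maps some `[c_2, z]` onto `[c, c_n]`,
hence `T^n` maps it monotonically onto `[c_2, c_{n+2}]`, and two more applications of `T` create
the points `u` and `v`. Moreover `s ≥ √2`, since otherwise `c_3 > p` and the critical orbit stays
at distance at least `c_3 - p` from `p`.

Conversely, let `s ∈ 𝒜`; then `c_3 < p` and `c` is not periodic. Given `y ≠ c` inside the core,
take `k` large, of the parity for which `R^k(c) < R^k(y)`. As `R^k(c) → p > c_3 = s c_2`, the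
inverse branch `t ↦ R^k(t) / s` of `T^{k+1}` sends `c` to a point `x ∈ [c_2, c]` and `y` to a point
to the right of `x`. The condition defining `𝒜` provides `T^n(c_2)` close to this second point;
since `T^n` is monotone on `[c_2, u]` and `T^n(u) = c_2 ≤ x`, some `[c_2, u'] ⊆ [c_2, u]` has
`T^n(u') = x`. Hence `k + n + 3` is a cutting time, and `c_{k+n+3}` is close to `y`.
-/

namespace TentMap

open Set Filter Topology

section IntervalMaps

variable {α β : Type*} [ConditionallyCompleteLinearOrder α] [TopologicalSpace α] [OrderTopology α]
  [DenselyOrdered α] [LinearOrder β] [TopologicalSpace β] [OrderClosedTopology β]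

lemma image_uIcc_of_continuousOn_of_injOn {f : α → β} {a b : α} (hf : ContinuousOn f (uIcc a b))
    (hinj : InjOn f (uIcc a b)) : f '' uIcc a b = uIcc (f a) (f b) := by
  rcases hf.strictMonoOn_of_injOn_Icc' inf_le_sup hinj with h | h
  · exact hf.image_uIcc_of_monotoneOn h.monotoneOn
  · exact hf.image_uIcc_of_antitoneOn h.antitoneOn

end IntervalMaps

lemma finite_preimage_iterate_singleton {α : Type*} {f : α → α}
    (hf : ∀ y, (f ⁻¹' {y}).Finite) (n : ℕ) (y : α) : (f^[n] ⁻¹' {y}).Finite := by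
  induction n with
  | zero => exact finite_singleton y
  | succ n ih =>
    rw [Function.iterate_succ, preimage_comp]
    exact ih.preimage' fun z _ => hf z

lemma leftInvOn_iterate {α : Type*} {f g : α → α} {S : Set α} (h : LeftInvOn f g S)
    (hg : MapsTo g S S) (n : ℕ) : LeftInvOn f^[n] g^[n] S := by
  induction n with
  | zero => exact fun _ _ => rfl
  | succ n ih =>
    intro x hx
    rw [Function.iterate_succ_apply f, Function.iterate_succ_apply' g, h (hg.iterate n hx), ih hx]

lemma IsMonotoneOn.injOn_of_finite_preimage {f : ℝ → ℝ} {a b : ℝ} (h : IsMonotoneOn f (Icc a b))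
    (hf : ∀ y, (f ⁻¹' {y}).Finite) : InjOn f (Icc a b) := by
  intro x hx y hy hxy
  wlog hlt : x < y generalizing x y
  · rcases (not_lt.1 hlt).lt_or_eq with hyx | rfl
    · exact (this hy hx hxy.symm hyx).symm
    · rfl
  refine absurd ((hf (f x)).subset fun t ht => ?_) (Icc_infinite hlt)
  have ht' : t ∈ Icc a b := ⟨hx.1.trans ht.1, ht.2.trans hy.2⟩
  rcases h with h | h
  · exact le_antisymm ((h ht' hy ht.2).trans_eq hxy.symm) (h hx ht' ht.1)
  · exact le_antisymm (h hx ht' ht.1) (hxy.trans_le (h ht' hy ht.2))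

/-! ### The tent map and its core -/

variable {s : ℝ}

lemma continuous_tent (s : ℝ) : Continuous (tent s) := by
  unfold tent; fun_prop

lemma tent_of_le_crit (hs : 0 ≤ s) {x : ℝ} (hx : x ≤ crit) : tent s x = s * x :=
  min_eq_left (by unfold crit at hx; gcongr; linarith)

lemma tent_of_crit_le (hs : 0 ≤ s) {x : ℝ} (hx : crit ≤ x) : tent s x = s * (1 - x) :=
  min_eq_right (by unfold crit at hx; gcongr; linarith)

lemma strictMonoOn_tent (hs : 0 < s) : StrictMonoOn (tent s) (Iic crit) := by
  intro x hx y hy hxy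
  rw [tent_of_le_crit hs.le hx, tent_of_le_crit hs.le hy]
  gcongr

lemma strictAntiOn_tent (hs : 0 < s) : StrictAntiOn (tent s) (Ici crit) := by
  intro x hx y hy hxy
  rw [tent_of_crit_le hs.le hx, tent_of_crit_le hs.le hy]
  gcongr

lemma finite_preimage_tent_singleton (hs : 0 < s) (y : ℝ) : (tent s ⁻¹' {y}).Finite := by
  refine (toFinite {y / s, 1 - y / s}).subset fun x hx => ?_
  rw [mem_preimage, mem_singleton_iff] at hx
  rcases le_total x crit with h | h
  · left
    rw [← hx, tent_of_le_crit hs.le h]; field_simp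
  · right
    rw [mem_singleton_iff, ← hx, tent_of_crit_le hs.le h]; field_simp; ring

lemma critOrbit_succ (s : ℝ) (n : ℕ) : critOrbit s (n + 1) = tent s (critOrbit s n) :=
  Function.iterate_succ_apply' _ _ _

lemma critOrbit_add (s : ℝ) (n k : ℕ) : critOrbit s (n + k) = (tent s)^[n] (critOrbit s k) :=
  Function.iterate_add_apply _ _ _ _

lemma tent_crit (s : ℝ) : tent s crit = critOrbit s 1 := rfl

lemma tent_le_critOrbit_one (hs : 0 < s) (x : ℝ) : tent s x ≤ critOrbit s 1 := by
  rcases le_total x crit with h | h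
  · exact (strictMonoOn_tent hs).monotoneOn h self_mem_Iic h
  · exact (strictAntiOn_tent hs).antitoneOn self_mem_Ici h h

lemma critOrbit_one (hs : 0 ≤ s) : critOrbit s 1 = s / 2 := by
  rw [← tent_crit, tent_of_le_crit hs le_rfl, crit]; ring

lemma crit_lt_critOrbit_one (hs : 1 < s) : crit < critOrbit s 1 := by
  rw [critOrbit_one (by linarith), crit]; linarith

lemma critOrbit_two (hs : 1 < s) : critOrbit s 2 = s - s ^ 2 / 2 := by
  have hs0 : 0 ≤ s := by linarith
  rw [critOrbit_succ, tent_of_crit_le hs0 (crit_lt_critOrbit_one hs).le, critOrbit_one hs0]; ring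

lemma critOrbit_two_lt_crit (hs : 1 < s) : critOrbit s 2 < crit := by
  rw [critOrbit_two hs, crit]; nlinarith [mul_pos (sub_pos.2 hs) (sub_pos.2 hs)]

lemma critOrbit_two_lt_critOrbit_one (hs : 1 < s) : critOrbit s 2 < critOrbit s 1 :=
  (critOrbit_two_lt_crit hs).trans (crit_lt_critOrbit_one hs)

lemma critOrbit_three (hs : 1 < s) : critOrbit s 3 = s * critOrbit s 2 := by
  rw [critOrbit_succ, tent_of_le_crit (by linarith) (critOrbit_two_lt_crit hs).le]

lemma mapsTo_tent_core (hs : 1 < s) (hs2 : s ≤ 2) : MapsTo (tent s) (core s) (core s) := by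
  have hs0 : 0 < s := by linarith
  rintro x ⟨hx2, hx1⟩
  refine ⟨?_, tent_le_critOrbit_one hs0 x⟩
  rcases le_total x crit with h | h
  · rw [critOrbit_two hs] at hx2 ⊢
    rw [tent_of_le_crit hs0.le h]
    nlinarith [mul_nonneg hs0.le (sub_nonneg.2 hs2), mul_nonneg hs0.le (sub_nonneg.2 hs.le)]
  · exact (strictAntiOn_tent hs0).antitoneOn h (h.trans hx1) hx1

lemma critOrbit_succ_mem_core (hs : 1 < s) (hs2 : s ≤ 2) (n : ℕ) :
    critOrbit s (n + 1) ∈ core s := by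
  rw [critOrbit_add s n 1]
  exact (mapsTo_tent_core hs hs2).iterate n
    (right_mem_Icc.2 (critOrbit_two_lt_critOrbit_one hs).le)

lemma injOn_tent_uIcc_crit (hs : 0 < s) (x : ℝ) : InjOn (tent s) (uIcc x crit) := by
  rcases le_total x crit with h | h
  · exact (strictMonoOn_tent hs).injOn.mono (uIcc_of_le h ▸ Icc_subset_Iic_self)
  · exact (strictAntiOn_tent hs).injOn.mono (uIcc_of_ge h ▸ Icc_subset_Ici_self)

lemma image_tent_uIcc_crit (hs : 0 < s) (x : ℝ) :
    tent s '' uIcc x crit = Icc (tent s x) (critOrbit s 1) := by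
  rw [image_uIcc_of_continuousOn_of_injOn (continuous_tent s).continuousOn
    (injOn_tent_uIcc_crit hs x), tent_crit, uIcc_of_le (tent_le_critOrbit_one hs x)]

lemma injOn_tent_of_crit_notMem (hs : 0 < s) {S : Set ℝ} [S.OrdConnected] (hS : crit ∉ S) :
    InjOn (tent s) S := by
  intro x hx y hy hxy
  rcases le_total x crit with hxc | hxc <;> rcases le_total y crit with hyc | hyc
  · exact (strictMonoOn_tent hs).injOn hxc hyc hxy
  · exact absurd (S.Icc_subset hx hy ⟨hxc, hyc⟩) hS
  · exact absurd (S.Icc_subset hy hx ⟨hyc, hxc⟩) hS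
  · exact (strictAntiOn_tent hs).injOn hxc hyc hxy

lemma not_injOn_tent_iterate (hs : 0 < s) {a b z : ℝ} (hz : z ∈ Ioo a b) {j n : ℕ} (hjn : j < n)
    (hzc : (tent s)^[j] z = crit) : ¬ InjOn (tent s)^[n] (Icc a b) := by
  obtain ⟨k, rfl⟩ := Nat.exists_eq_add_of_lt hjn
  rw [show j + k + 1 = k + (j + 1) by ring, Function.iterate_add]
  intro hinj
  have hab : a ≤ b := (hz.1.trans hz.2).le
  have hmax : ∀ x, (tent s)^[j + 1] x ≤ (tent s)^[j + 1] z := fun x => by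
    rw [Function.iterate_succ_apply', Function.iterate_succ_apply', hzc]
    exact tent_le_critOrbit_one hs _
  have hz' : z ∈ Icc a b := Ioo_subset_Icc_self hz
  rcases ((continuous_tent s).iterate (j + 1)).continuousOn.strictMonoOn_of_injOn_Icc' hab
    hinj.of_comp with h | h
  · exact (h hz' (right_mem_Icc.2 hab) hz.2).not_ge (hmax b)
  · exact (h (left_mem_Icc.2 hab) hz' hz.1).not_ge (hmax a)

/-! ### The Hofbauer tower -/

lemma hofbauer_add_two_of_mem {n : ℕ} (h : crit ∈ hofbauer s (n + 1)) :
    hofbauer s (n + 2) = Icc (critOrbit s (n + 2)) (critOrbit s 1) := by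
  rw [hofbauer, if_pos h]

lemma hofbauer_add_two_of_notMem {n : ℕ} (h : crit ∉ hofbauer s (n + 1)) :
    hofbauer s (n + 2) = tent s '' hofbauer s (n + 1) := by
  rw [hofbauer, if_neg h]

lemma isCuttingTime_one (hs : 1 < s) : IsCuttingTime s 1 := by
  rw [IsCuttingTime, hofbauer]
  exact left_mem_Icc.2 (crit_lt_critOrbit_one hs).le

lemma image_tent_iterate_Icc {n : ℕ} {z : ℝ} (hz : critOrbit s 2 ≤ z)
    (hinj : InjOn (tent s)^[n] (Icc (critOrbit s 2) z)) :
    (tent s)^[n] '' Icc (critOrbit s 2) z = uIcc (critOrbit s (n + 2)) ((tent s)^[n] z) := by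
  rw [← uIcc_of_le hz] at hinj ⊢
  rw [critOrbit_add]
  exact image_uIcc_of_continuousOn_of_injOn ((continuous_tent s).iterate n).continuousOn hinj

-- The last clause makes `[c_2, z]` maximal within the core, provided `z ≠ c_2`.
lemma exists_hofbauer_add_two_eq_image (hs : 1 < s) (n : ℕ) :
    ∃ z ∈ core s, hofbauer s (n + 2) = (tent s)^[n] '' Icc (critOrbit s 2) z ∧
      InjOn (tent s)^[n] (Icc (critOrbit s 2) z) ∧
      (z = critOrbit s 1 ∨ ∃ j < n, (tent s)^[j] z = crit) := by
  have hs0 : 0 < s := by linarith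
  induction n with
  | zero =>
    refine ⟨critOrbit s 1, right_mem_Icc.2 (critOrbit_two_lt_critOrbit_one hs).le, ?_,
      injOn_id _, .inl rfl⟩
    rw [hofbauer_add_two_of_mem (isCuttingTime_one hs), Function.iterate_zero, image_id]
  | succ n ih =>
    obtain ⟨z, hz, hD, hinj, hend⟩ := ih
    simp only [Function.iterate_succ', image_comp]
    by_cases hc : crit ∈ hofbauer s (n + 2)
    · obtain ⟨w, hw, hwc⟩ : crit ∈ (tent s)^[n] '' Icc (critOrbit s 2) z := hD ▸ hc
      have hinjw := hinj.mono (Icc_subset_Icc_right hw.2)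
      have himg := image_tent_iterate_Icc hw.1 hinjw
      rw [hwc] at himg
      refine ⟨w, ⟨hw.1, hw.2.trans hz.2⟩, ?_, ?_, .inr ⟨n, n.lt_succ_self, hwc⟩⟩
      · rw [hofbauer_add_two_of_mem hc, himg, image_tent_uIcc_crit hs0, ← critOrbit_succ]
      · exact (himg ▸ injOn_tent_uIcc_crit hs0 _).comp hinjw (mapsTo_image _ _)
    · refine ⟨z, hz, by rw [hofbauer_add_two_of_notMem hc, hD], ?_,
        hend.imp_right fun ⟨j, hj, hjz⟩ => ⟨j, hj.trans n.lt_succ_self, hjz⟩⟩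
      rw [hD] at hc
      have himg := image_tent_iterate_Icc hz.1 hinj
      rw [himg] at hc
      exact (himg ▸ injOn_tent_of_crit_notMem hs0 hc).comp hinj (mapsTo_image _ _)

lemma exists_injOn_iterate_of_isCuttingTime (hs : 1 < s) {n : ℕ}
    (h : IsCuttingTime s (n + 2)) :
    ∃ z ∈ core s, InjOn (tent s)^[n] (Icc (critOrbit s 2) z) ∧ (tent s)^[n] z = crit := by
  obtain ⟨z, hz, hD, hinj, -⟩ := exists_hofbauer_add_two_eq_image hs n
  obtain ⟨w, hw, hwc⟩ : crit ∈ (tent s)^[n] '' Icc (critOrbit s 2) z := hD ▸ h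
  exact ⟨w, ⟨hw.1, hw.2.trans hz.2⟩, hinj.mono (Icc_subset_Icc_right hw.2), hwc⟩

lemma isCuttingTime_of_injOn_iterate (hs : 1 < s)
    (hper : crit ∉ Function.periodicPts (tent s)) {n : ℕ} {u : ℝ} (hu : u ∈ core s)
    (hinj : InjOn (tent s)^[n] (Icc (critOrbit s 2) u)) (huc : (tent s)^[n] u = crit) :
    IsCuttingTime s (n + 2) := by
  obtain ⟨z, hz, hD, -, hend⟩ := exists_hofbauer_add_two_eq_image hs n
  rw [IsCuttingTime, hD]
  refine ⟨u, ⟨hu.1, ?_⟩, huc⟩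
  rcases hend with rfl | ⟨j, hj, hjz⟩
  · exact hu.2
  · by_contra! hzu
    have hz2 : critOrbit s 2 ≠ z := by
      rintro rfl
      rw [← critOrbit_add] at hjz
      exact hper (Function.mk_mem_periodicPts (by omega) hjz)
    exact not_injOn_tent_iterate (by linarith) ⟨hz.1.lt_of_ne hz2, hzu⟩ hj hjz hinj

/-- The set `{c_{S_k} : k ≥ 1}` of the orbit points at the cutting times after the first. If there
were only finitely many cutting times, `Nat.nth` would return `0` and the set would contain `c`. -/
def cuttingOrbit (s : ℝ) : Set ℝ :=
  {x : ℝ | ∃ k : ℕ, 1 ≤ k ∧ x = critOrbit s (cuttingTime s k)}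

lemma critOrbit_mem_cuttingOrbit (hs : 1 < s) {n : ℕ} (hn : 1 < n) (h : IsCuttingTime s n) :
    critOrbit s n ∈ cuttingOrbit s := by
  classical
  exact ⟨Nat.count (IsCuttingTime s) n,
    (Nat.zero_le _).trans_lt (Nat.count_strict_mono (isCuttingTime_one hs) hn),
    by rw [cuttingTime, Nat.nth_count h]⟩

lemma exists_isCuttingTime_of_mem_cuttingOrbit {x : ℝ} (hx : x ∈ cuttingOrbit s)
    (hxc : x ≠ crit) : ∃ n, IsCuttingTime s n ∧ critOrbit s n = x := by
  obtain ⟨k, -, rfl⟩ := hx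
  refine ⟨cuttingTime s k, Nat.nth_mem_of_ne_zero fun h0 => hxc ?_, rfl⟩
  rw [cuttingTime, h0]
  rfl

lemma cuttingOrbit_subset_range (s : ℝ) : cuttingOrbit s ⊆ range (critOrbit s) := by
  rintro _ ⟨k, -, rfl⟩
  exact mem_range_self _

/-! ### The gap around the fixed point -/

/-- The fixed point of `T_s` to the right of `c`. -/
noncomputable def fixedPt (s : ℝ) : ℝ := s / (1 + s)

lemma crit_lt_fixedPt (hs : 1 < s) : crit < fixedPt s := by
  rw [crit, fixedPt, div_lt_div_iff₀ two_pos (by linarith)]; linarith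

lemma fixedPt_mem_core (hs : 1 < s) : fixedPt s ∈ core s := by
  refine ⟨((critOrbit_two_lt_crit hs).trans (crit_lt_fixedPt hs)).le, ?_⟩
  rw [critOrbit_one (by linarith), fixedPt]
  gcongr
  linarith

lemma tent_sub_fixedPt (hs : 0 ≤ s) {x : ℝ} (hx : crit ≤ x) :
    tent s x - fixedPt s = -s * (x - fixedPt s) := by
  have : 1 + s ≠ 0 := by positivity
  rw [tent_of_crit_le hs hx, fixedPt]; field_simp; ring

lemma isFixedPt_tent_fixedPt (hs : 1 < s) : Function.IsFixedPt (tent s) (fixedPt s) := by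
  have h := tent_sub_fixedPt (by linarith) (crit_lt_fixedPt hs).le
  rwa [sub_self, mul_zero, sub_eq_zero] at h

lemma critOrbit_three_sub_fixedPt (hs : 1 < s) :
    critOrbit s 3 - fixedPt s = s * (2 - s ^ 2) * (fixedPt s - crit) := by
  have : 1 + s ≠ 0 := by positivity
  rw [critOrbit_three hs, critOrbit_two hs, fixedPt, crit]; field_simp; ring

-- `T` expands distances to the fixed point on `[c, c_1]` and sends `[c_2, c]` beyond `c_3`.
lemma critOrbit_three_sub_fixedPt_le_abs (hs : 1 < s) (hs2 : s ≤ 2) (n : ℕ) :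
    critOrbit s 3 - fixedPt s ≤ |critOrbit s n - fixedPt s| := by
  have hs0 : 0 ≤ s := by linarith
  induction n with
  | zero =>
    have hcp := sub_pos.2 (crit_lt_fixedPt hs)
    have hle : s * (2 - s ^ 2) ≤ 1 := by
      nlinarith [mul_nonneg (sub_nonneg.2 hs.le) (by nlinarith : 0 ≤ s ^ 2 + s - 1)]
    rw [critOrbit_three_sub_fixedPt hs, abs_sub_comm]
    exact (mul_le_of_le_one_left hcp.le hle).trans (le_abs_self _)
  | succ n ih =>
    rw [critOrbit_succ s n]
    rcases le_or_gt crit (critOrbit s n) with h | h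
    · rw [tent_sub_fixedPt hs0 h, abs_mul, abs_neg, abs_of_nonneg hs0]
      exact ih.trans (le_mul_of_one_le_left (abs_nonneg _) hs.le)
    · obtain ⟨k, rfl⟩ : ∃ k, n = k + 1 :=
        Nat.exists_eq_succ_of_ne_zero fun h0 => by subst h0; exact lt_irrefl _ h
      refine (sub_le_sub_right ?_ _).trans (le_abs_self _)
      rw [critOrbit_three hs, tent_of_le_crit hs0 h.le]
      gcongr
      exact (critOrbit_succ_mem_core hs hs2 k).1

lemma two_le_sq_of_core_subset_closure_range (hs : 1 < s) (hs2 : s ≤ 2)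
    (h : core s ⊆ closure (range (critOrbit s))) : 2 ≤ s ^ 2 := by
  by_contra! hlt
  have hgap : 0 < critOrbit s 3 - fixedPt s := by
    rw [critOrbit_three_sub_fixedPt hs]
    exact mul_pos (mul_pos (by linarith) (by linarith)) (sub_pos.2 (crit_lt_fixedPt hs))
  obtain ⟨_, ⟨n, rfl⟩, hn⟩ := Metric.mem_closure_iff.1 (h (fixedPt_mem_core hs)) _ hgap
  rw [dist_comm, Real.dist_eq] at hn
  exact hn.not_ge (critOrbit_three_sub_fixedPt_le_abs hs hs2 n)

/-! ### The right-hand inverse branch -/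

/-- The inverse of the right-hand branch of `T_s`, defined on all of `ℝ`; it maps the core into
`[c, c_1]`. -/
noncomputable def rightInv (s y : ℝ) : ℝ := 1 - y / s

lemma continuous_rightInv (s : ℝ) : Continuous (rightInv s) := by
  unfold rightInv; fun_prop

lemma strictAnti_rightInv (hs : 0 < s) : StrictAnti (rightInv s) := fun x y hxy => by
  unfold rightInv; gcongr

lemma rightInv_critOrbit_one (hs : 0 < s) : rightInv s (critOrbit s 1) = crit := by
  rw [critOrbit_one hs.le, rightInv, crit]; field_simp; norm_num

lemma rightInv_critOrbit_two (hs : 1 < s) : rightInv s (critOrbit s 2) = critOrbit s 1 := by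
  rw [critOrbit_two hs, critOrbit_one (by linarith), rightInv]; field_simp; ring

lemma mapsTo_rightInv_Icc (hs : 1 < s) :
    MapsTo (rightInv s) (core s) (Icc crit (critOrbit s 1)) := by
  have h := (strictAnti_rightInv (by linarith)).antitone.mapsTo_Icc
    (a := critOrbit s 2) (b := critOrbit s 1)
  rwa [rightInv_critOrbit_one (by linarith), rightInv_critOrbit_two hs] at h

lemma mapsTo_rightInv_Ioo (hs : 1 < s) :
    MapsTo (rightInv s) (Ioo (critOrbit s 2) (critOrbit s 1)) (Ioo crit (critOrbit s 1)) := by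
  have h := (strictAnti_rightInv (by linarith)).mapsTo_Ioo
    (a := critOrbit s 2) (b := critOrbit s 1)
  rwa [rightInv_critOrbit_one (by linarith), rightInv_critOrbit_two hs] at h

lemma mapsTo_rightInv_core (hs : 1 < s) : MapsTo (rightInv s) (core s) (core s) :=
  (mapsTo_rightInv_Icc hs).mono_right (Icc_subset_Icc_left (critOrbit_two_lt_crit hs).le)

lemma leftInvOn_tent_rightInv (hs : 1 < s) : LeftInvOn (tent s) (rightInv s) (core s) := by
  intro y hy
  rw [tent_of_crit_le (by linarith) (mapsTo_rightInv_Icc hs hy).1, rightInv]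
  field_simp; ring

lemma tent_iterate_rightInv_iterate (hs : 1 < s) (n : ℕ) {y : ℝ} (hy : y ∈ core s) :
    (tent s)^[n] ((rightInv s)^[n] y) = y :=
  leftInvOn_iterate (leftInvOn_tent_rightInv hs) (mapsTo_rightInv_core hs) n hy

lemma crit_lt_tent_iterate_rightInv_iterate (hs : 1 < s) {i k : ℕ} (hik : i < k) {y : ℝ}
    (hy : y ∈ Ioo (critOrbit s 2) (critOrbit s 1)) :
    crit < (tent s)^[i] ((rightInv s)^[k] y) := by
  obtain ⟨j, rfl⟩ := Nat.exists_eq_add_of_lt hik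
  have hmem : (rightInv s)^[j] y ∈ Ioo (critOrbit s 2) (critOrbit s 1) :=
    ((mapsTo_rightInv_Ioo hs).mono_right
      (Ioo_subset_Ioo_left (critOrbit_two_lt_crit hs).le)).iterate j hy
  have hmem' := mapsTo_rightInv_Ioo hs hmem
  rw [add_assoc, Function.iterate_add_apply, tent_iterate_rightInv_iterate hs,
    Function.iterate_succ_apply']
  · exact hmem'.1
  · rw [Function.iterate_succ_apply']
    exact mapsTo_rightInv_core hs (Ioo_subset_Icc_self hmem)

/-! ### From density to `𝒜` -/

lemma exists_isCuttingTime_forall_crit_lt (hs : 1 < s) (h : core s ⊆ closure (cuttingOrbit s))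
    {k : ℕ} (hk : 0 < k) {W : Set ℝ} (hW : IsOpen W) {b : ℝ} (hbW : b ∈ W)
    (hb : b ∈ Ioo (critOrbit s 2) (critOrbit s 1)) :
    ∃ n, IsCuttingTime s n ∧ (∀ i < k, crit < critOrbit s (i + n)) ∧ critOrbit s (k + n) ∈ W := by
  have hcont := (continuous_tent s).iterate
  have hopen : IsOpen ((⋂ i ∈ Iio k, (tent s)^[i] ⁻¹' Ioi crit) ∩ (tent s)^[k] ⁻¹' W) :=
    ((finite_Iio k).isOpen_biInter fun i _ => isOpen_Ioi.preimage (hcont i)).inter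
      (hW.preimage (hcont k))
  have hbcore := Ioo_subset_Icc_self hb
  obtain ⟨x, ⟨hx, hxW⟩, hxS⟩ := mem_closure_iff.1
    (h ((mapsTo_rightInv_core hs).iterate k hbcore)) _ hopen
    ⟨mem_iInter₂.2 fun i hi => crit_lt_tent_iterate_rightInv_iterate hs hi hb,
      by rwa [mem_preimage, tent_iterate_rightInv_iterate hs k hbcore]⟩
  rw [mem_iInter₂] at hx
  obtain ⟨n, hn, rfl⟩ := exists_isCuttingTime_of_mem_cuttingOrbit hxS (hx 0 hk).ne'
  simp only [critOrbit_add]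
  exact ⟨n, hn, hx, hxW⟩

lemma strictMonoOn_tent_tent (hs : 0 < s) {y : ℝ} (hy : crit ≤ tent s y) :
    StrictMonoOn (tent s)^[2] (Icc crit y) :=
  (strictAntiOn_tent hs).comp ((strictAntiOn_tent hs).mono Icc_subset_Ici_self) fun _ hx =>
    hy.trans ((strictAntiOn_tent hs).antitoneOn hx.1 (hx.1.trans hx.2) hx.2)

lemma strictAntiOn_tent_tent (hs : 0 < s) {w : ℝ} (hw : crit ≤ tent s w) :
    StrictAntiOn (tent s)^[2] (Icc w crit) :=
  (strictAntiOn_tent hs).comp_strictMonoOn ((strictMonoOn_tent hs).mono Icc_subset_Iic_self)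
    fun _ hx => hw.trans ((strictMonoOn_tent hs).monotoneOn (hx.1.trans hx.2) hx.2 hx.1)

lemma exists_tent_tent_eq_crit (hs : 1 < s) :
    ∃ w ∈ Ioo (critOrbit s 2) crit, crit ≤ tent s w ∧ (tent s)^[2] w = crit := by
  have hs0 : 0 < s := by linarith
  have hcrit : crit ∈ Ioo (critOrbit s 2) (critOrbit s 1) :=
    ⟨critOrbit_two_lt_crit hs, crit_lt_critOrbit_one hs⟩
  have hR := mapsTo_rightInv_Ioo hs hcrit
  have hlt : critOrbit s 2 < rightInv s crit / s := by
    have hsub : rightInv s crit - s * critOrbit s 2 = (s - 1) ^ 3 * (s + 1) / (2 * s) := by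
      rw [critOrbit_two hs, rightInv, crit]; field_simp; ring
    have : 0 < (s - 1) ^ 3 * (s + 1) / (2 * s) := by
      have := sub_pos.2 hs
      positivity
    rw [lt_div_iff₀ hs0]; linarith
  have hlt' : rightInv s crit / s < crit := by
    have := hR.2
    rw [critOrbit_one hs0.le] at this
    rw [crit, div_lt_iff₀ hs0]; linarith!
  have hT : tent s (rightInv s crit / s) = rightInv s crit := by
    rw [tent_of_le_crit hs0.le hlt'.le, mul_div_cancel₀ _ hs0.ne']
  refine ⟨_, ⟨hlt, hlt'⟩, hR.1.le.trans_eq hT.symm, ?_⟩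
  rw [Function.iterate_succ_apply, hT]
  exact leftInvOn_tent_rightInv hs (Ioo_subset_Icc_self hcrit)

lemma strictAntiOn_tent_iterate_add_two (hs : 0 < s) {m : ℕ} {z : ℝ} (hz : critOrbit s 2 ≤ z)
    (hinj : InjOn (tent s)^[m] (Icc (critOrbit s 2) z)) (hzc : (tent s)^[m] z = crit)
    (h0 : crit < critOrbit s (m + 2)) (h1 : crit ≤ critOrbit s (m + 3)) :
    StrictAntiOn (tent s)^[2 + m] (Icc (critOrbit s 2) z) := by
  have himg := image_tent_iterate_Icc hz hinj
  rw [hzc, uIcc_of_ge h0.le] at himg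
  rw [Function.iterate_add]
  refine (strictMonoOn_tent_tent hs (by rwa [← critOrbit_succ])).comp_strictAntiOn ?_
    (himg ▸ mapsTo_image _ _)
  have hmonoanti :=
    ((continuous_tent s).iterate m).continuousOn.strictMonoOn_of_injOn_Icc' hz hinj
  refine hmonoanti.resolve_left fun hmono => ?_
  have hle := hmono.monotoneOn (left_mem_Icc.2 hz) (right_mem_Icc.2 hz) hz
  rw [hzc, ← critOrbit_add] at hle
  exact h0.not_ge hle

-- `u` and `v` are the preimages under `f` of `c` and of the point `w ∈ (c_2, c)` with `T² w = c`.
lemma exists_tent_tent_comp_eq (hs : 1 < s) {f : ℝ → ℝ} {x z : ℝ} (hxz : x ≤ z)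
    (hf : ContinuousOn f (Icc x z)) (hanti : StrictAntiOn f (Icc x z)) (hfx : crit < f x)
    (hTfx : crit ≤ tent s (f x)) (hfz : f z = critOrbit s 2) :
    ∃ u v, x < u ∧ u < v ∧ v < z ∧
      (tent s)^[2] (f u) = critOrbit s 2 ∧ (tent s)^[2] (f v) = crit ∧
      AntitoneOn ((tent s)^[2] ∘ f) (Icc x u) ∧ MonotoneOn ((tent s)^[2] ∘ f) (Icc u v) := by
  have hs0 : 0 < s := by linarith
  obtain ⟨w, hw, hTw, hTTw⟩ := exists_tent_tent_eq_crit hs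
  obtain ⟨u, hu, hfu⟩ := intermediate_value_Ioo' hxz hf
    (show crit ∈ Ioo (f z) (f x) from ⟨hfz ▸ critOrbit_two_lt_crit hs, hfx⟩)
  obtain ⟨v, hv, hfv⟩ := intermediate_value_Ioo' hu.2.le (hf.mono (Icc_subset_Icc_left hu.1.le))
    (show w ∈ Ioo (f z) (f u) by rwa [hfz, hfu])
  have hxu : Icc x u ⊆ Icc x z := Icc_subset_Icc_right hu.2.le
  have huv : Icc u v ⊆ Icc x z := Icc_subset_Icc hu.1.le hv.2.le
  have hmaps_xu := (hanti.antitoneOn.mono hxu).mapsTo_Icc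
  have hmaps_uv := (hanti.antitoneOn.mono huv).mapsTo_Icc
  rw [hfu] at hmaps_xu hmaps_uv
  rw [hfv] at hmaps_uv
  exact ⟨u, v, hu.1, hv.1, hv.2, by rw [hfu]; rfl, by rw [hfv, hTTw],
    ((strictMonoOn_tent_tent hs0 hTfx).comp_strictAntiOn (hanti.mono hxu) hmaps_xu).antitoneOn,
    ((strictAntiOn_tent_tent hs0 hTw).comp (hanti.mono huv) hmaps_uv).monotoneOn⟩

lemma exists_isMonotoneOn_iterate_of_isCuttingTime (hs : 1 < s) {m : ℕ}
    (h : IsCuttingTime s (m + 2)) (hright : ∀ i < 4, crit < critOrbit s (i + (m + 2))) :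
    ∃ u v, critOrbit s 2 < u ∧ u < v ∧ v < critOrbit s 1 ∧
      (tent s)^[m + 4] u = critOrbit s 2 ∧ (tent s)^[m + 4] v = crit ∧
      IsMonotoneOn (tent s)^[m + 4] (Icc (critOrbit s 2) u) ∧
      IsMonotoneOn (tent s)^[m + 4] (Icc u v) := by
  simp only [add_comm _ (m + 2)] at hright
  obtain ⟨z, hz, hinj, hzc⟩ := exists_injOn_iterate_of_isCuttingTime hs h
  have hanti := strictAntiOn_tent_iterate_add_two (by linarith) hz.1 hinj hzc
    (hright 0 (by norm_num)) (hright 1 (by norm_num)).le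
  have hc2 : (tent s)^[2 + m] (critOrbit s 2) = critOrbit s (m + 2 + 2) := by
    rw [← critOrbit_add, add_comm 2 m]
  obtain ⟨u, v, hu, huv, hvz, hfu, hfv, hxu, huv'⟩ := exists_tent_tent_comp_eq hs hz.1
    ((continuous_tent s).iterate (2 + m)).continuousOn hanti
    (hc2 ▸ hright 2 (by norm_num))
    (by rw [hc2, ← critOrbit_succ]; exact (hright 3 (by norm_num)).le)
    (by rw [Function.iterate_add_apply, hzc]; rfl)
  rw [show m + 4 = 2 + (2 + m) by ring, Function.iterate_add _ 2]
  exact ⟨u, v, hu, huv, hvz.trans_le hz.2, hfu, hfv, .inr hxu, .inl huv'⟩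

lemma mem_bargeBrucksDiamond_of_core_subset_closure (hs : 1 < s) (hs2 : s ≤ 2)
    (h : core s ⊆ closure (cuttingOrbit s)) : s ∈ bargeBrucksDiamond := by
  have hs0 : 0 < s := by linarith
  have hsq := two_le_sq_of_core_subset_closure_range hs hs2
    (h.trans (closure_mono (cuttingOrbit_subset_range s)))
  refine ⟨⟨Real.sqrt_le_iff.2 ⟨hs0.le, hsq⟩, hs2⟩, fun a ha δ hδ => ?_⟩
  obtain ⟨b, hbδ, hb⟩ : (Ioo (a - δ) (a + δ) ∩ Ioo (critOrbit s 2) crit).Nonempty := by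
    rw [← closure_Ioo (critOrbit_two_lt_crit hs).ne] at ha
    exact mem_closure_iff.1 ha _ isOpen_Ioo ⟨by linarith, by linarith⟩
  obtain ⟨n, hn, hright, hnδ⟩ := exists_isCuttingTime_forall_crit_lt hs h four_pos isOpen_Ioo hbδ
    (Ioo_subset_Ioo_right (crit_lt_critOrbit_one hs).le hb)
  obtain ⟨m, rfl⟩ : ∃ m, n = m + 2 := by
    rcases n with _ | _ | m
    · exact absurd (hright 0 (by norm_num)) (lt_irrefl _)
    · exact absurd (hright 1 (by norm_num)) (critOrbit_two_lt_crit hs).not_gt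
    · exact ⟨m, rfl⟩
  obtain ⟨u, v, hu, huv, hv, hfu, hfv, hxu, huv'⟩ :=
    exists_isMonotoneOn_iterate_of_isCuttingTime hs hn hright
  refine ⟨m + 4, by omega, u, v, hu, huv, hv, ?_, hfu, hfv, hxu, huv'⟩
  rwa [← critOrbit_add, show m + 4 + 2 = 4 + (m + 2) by ring]

/-! ### From `𝒜` to density -/

lemma two_lt_sq_of_mem_bargeBrucksDiamond (hs : 1 < s) (h : s ∈ bargeBrucksDiamond) :
    2 < s ^ 2 := by
  have hc2 := critOrbit_two_lt_crit hs
  refine ((Real.sqrt_le_left (by linarith)).1 h.1.1).lt_of_ne fun heq => ?_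
  have hfixed : critOrbit s 3 = fixedPt s := by
    rw [← sub_eq_zero, critOrbit_three_sub_fixedPt hs, ← heq, sub_self, mul_zero, zero_mul]
  obtain ⟨n, hn, -, -, -, -, -, hnc, -⟩ := h.2 _ (left_mem_Icc.2 hc2.le) _ (sub_pos.2 hc2)
  obtain ⟨k, rfl⟩ := Nat.exists_eq_add_of_le' hn
  rw [Function.iterate_succ_apply, ← critOrbit_succ, hfixed,
    (isFixedPt_tent_fixedPt hs).iterate k, add_sub_cancel] at hnc
  exact hnc.2.not_gt (crit_lt_fixedPt hs)

lemma crit_notMem_periodicPts_of_mem_bargeBrucksDiamond (hs : 1 < s)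
    (h : s ∈ bargeBrucksDiamond) : crit ∉ Function.periodicPts (tent s) := by
  rintro ⟨p, hp, hper⟩
  have hfin : (range (critOrbit s)).Finite := by
    refine ((finite_Iio p).image (critOrbit s)).subset ?_
    rintro _ ⟨n, rfl⟩
    exact ⟨n % p, Nat.mod_lt _ hp, hper.iterate_mod_apply n⟩
  refine Icc_infinite (critOrbit_two_lt_crit hs) (hfin.subset fun a ha => ?_)
  rw [← hfin.isClosed.closure_eq, Metric.mem_closure_iff]
  intro δ hδ
  obtain ⟨n, -, -, -, -, -, -, hn, -⟩ := h.2 a ha δ hδ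
  rw [← critOrbit_add, ← Real.ball_eq_Ioo] at hn
  exact ⟨_, mem_range_self (n + 2), Metric.mem_ball'.1 hn⟩

lemma isCuttingTime_iterate_add (hs : 1 < s)
    (hper : crit ∉ Function.periodicPts (tent s)) {M n : ℕ} {x u : ℝ} (hu : u ∈ core s)
    (hmono : IsMonotoneOn (tent s)^[n] (Icc (critOrbit s 2) u))
    (hx : x ∈ Icc ((tent s)^[n] u) (critOrbit s (n + 2)))
    (hinj : InjOn (tent s)^[M] (Icc x (critOrbit s (n + 2)))) (hxc : (tent s)^[M] x = crit) :
    IsCuttingTime s (M + n + 2) := by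
  have hs0 : 0 < s := by linarith
  have hinjn := hmono.injOn_of_finite_preimage
    (finite_preimage_iterate_singleton (finite_preimage_tent_singleton hs0) n)
  have hcont := ((continuous_tent s).iterate n).continuousOn (s := Icc (critOrbit s 2) u)
  obtain ⟨u', hu', rfl⟩ := intermediate_value_Icc' hu.1 hcont (critOrbit_add s n 2 ▸ hx)
  have hinju' := hinjn.mono (Icc_subset_Icc_right hu'.2)
  have himg := image_tent_iterate_Icc hu'.1 hinju'
  rw [uIcc_of_ge hx.2] at himg
  refine isCuttingTime_of_injOn_iterate hs hper ⟨hu'.1, hu'.2.trans hu.2⟩ ?_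
    (by rwa [Function.iterate_add_apply])
  rw [Function.iterate_add]
  exact hinj.comp hinju' (himg ▸ mapsTo_image _ _)

lemma iterate_mem_closure_cuttingOrbit (hs : 1 < s) (h : s ∈ bargeBrucksDiamond)
    {M : ℕ} {x z r : ℝ} (hx : critOrbit s 2 ≤ x) (hz : z ∈ Ioo x r) (hzc : z ≤ crit)
    (hinj : InjOn (tent s)^[M] (Icc x r)) (hxc : (tent s)^[M] x = crit) :
    (tent s)^[M] z ∈ closure (cuttingOrbit s) := by
  refine mem_closure_iff.2 fun U hU hzU => ?_
  obtain ⟨δ, hδ, hsub⟩ := Metric.isOpen_iff.1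
    (isOpen_Ioo.inter (hU.preimage ((continuous_tent s).iterate M))) z ⟨hz, hzU⟩
  obtain ⟨n, -, u, v, hu, huv, hv, hn, hfu, -, hmono, -⟩ := h.2 z ⟨hx.trans hz.1.le, hzc⟩ δ hδ
  rw [← critOrbit_add, ← Real.ball_eq_Ioo] at hn
  obtain ⟨⟨hxn, hnr⟩, hnU⟩ := hsub hn
  refine ⟨critOrbit s (M + n + 2), by rwa [add_assoc, critOrbit_add],
    critOrbit_mem_cuttingOrbit hs (by omega) ?_⟩
  exact isCuttingTime_iterate_add hs (crit_notMem_periodicPts_of_mem_bargeBrucksDiamond hs h)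
    ⟨hu.le, (huv.trans hv).le⟩ hmono ⟨hfu.trans_le hx, hxn.le⟩
    (hinj.mono (Icc_subset_Icc_right hnr.le)) hxc

lemma rightInv_iterate_sub_fixedPt (hs : 0 < s) (n : ℕ) (y : ℝ) :
    (rightInv s)^[n] y - fixedPt s = (-s⁻¹) ^ n * (y - fixedPt s) := by
  induction n with
  | zero => simp
  | succ n ih =>
    have hstep (t : ℝ) : rightInv s t - fixedPt s = -s⁻¹ * (t - fixedPt s) := by
      rw [rightInv, fixedPt]; field_simp; ring
    rw [Function.iterate_succ_apply', hstep, ih, pow_succ', mul_assoc]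

lemma tendsto_rightInv_iterate (hs : 1 < s) (y : ℝ) :
    Tendsto (fun n => (rightInv s)^[n] y) atTop (𝓝 (fixedPt s)) := by
  have hpow : Tendsto (fun n => (-s⁻¹) ^ n) atTop (𝓝 0) := by
    apply tendsto_pow_atTop_nhds_zero_of_abs_lt_one
    rw [abs_neg, abs_of_pos (by positivity)]
    exact inv_lt_one_of_one_lt₀ hs
  rw [← tendsto_sub_nhds_zero_iff]
  simpa only [rightInv_iterate_sub_fixedPt (zero_lt_one.trans hs), zero_mul] using
    hpow.mul_const (y - fixedPt s)

lemma rightInv_iterate_div_le_crit (hs : 1 < s) (n : ℕ) {y : ℝ} (hy : y ∈ core s) :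
    (rightInv s)^[n] y / s ≤ crit := by
  have hs0 : 0 < s := by linarith
  have hle := ((mapsTo_rightInv_core hs).iterate n hy).2
  rw [critOrbit_one hs0.le] at hle
  rw [crit, div_le_iff₀ hs0]; linarith

lemma tent_iterate_succ_rightInv_iterate_div (hs : 1 < s) (n : ℕ) {y : ℝ} (hy : y ∈ core s) :
    (tent s)^[n + 1] ((rightInv s)^[n] y / s) = y := by
  have hs0 : 0 < s := by linarith
  rw [Function.iterate_succ_apply, tent_of_le_crit hs0.le (rightInv_iterate_div_le_crit hs n hy),
    mul_div_cancel₀ _ hs0.ne', tent_iterate_rightInv_iterate hs n hy]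

lemma injOn_tent_iterate_succ_Icc (hs : 1 < s) (n : ℕ) {y y' : ℝ} (hy : y ∈ core s)
    (hy' : y' ∈ core s) :
    InjOn (tent s)^[n + 1] (Icc ((rightInv s)^[n] y / s) ((rightInv s)^[n] y' / s)) := by
  have hcont : Continuous fun t => (rightInv s)^[n] t / s :=
    ((continuous_rightInv s).iterate n).div_const s
  have hinv : LeftInvOn (tent s)^[n + 1] (fun t => (rightInv s)^[n] t / s) (core s) :=
    fun t ht => tent_iterate_succ_rightInv_iterate_div hs n ht
  refine hinv.rightInvOn_image.injOn.mono fun q hq => ?_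
  obtain ⟨t, ht, rfl⟩ := intermediate_value_uIcc hcont.continuousOn (Icc_subset_uIcc hq)
  exact mem_image_of_mem _ (uIcc_subset_Icc hy hy' ht)

lemma mem_closure_cuttingOrbit_of_rightInv_iterate_lt (hs : 1 < s) (h : s ∈ bargeBrucksDiamond)
    {n : ℕ} {y e : ℝ} (hy : y ∈ core s) (he : e ∈ core s)
    (hn : critOrbit s 3 ≤ (rightInv s)^[n] crit)
    (hcy : (rightInv s)^[n] crit < (rightInv s)^[n] y)
    (hye : (rightInv s)^[n] y < (rightInv s)^[n] e) : y ∈ closure (cuttingOrbit s) := by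
  have hs0 : 0 < s := by linarith
  have hc : crit ∈ core s := ⟨(critOrbit_two_lt_crit hs).le, (crit_lt_critOrbit_one hs).le⟩
  have hmem := iterate_mem_closure_cuttingOrbit hs h (M := n + 1)
    (x := (rightInv s)^[n] crit / s) (z := (rightInv s)^[n] y / s) (r := (rightInv s)^[n] e / s)
    ?_ ⟨by gcongr, by gcongr⟩ (rightInv_iterate_div_le_crit hs n hy)
    (injOn_tent_iterate_succ_Icc hs n hc he) (tent_iterate_succ_rightInv_iterate_div hs n hc)
  · rwa [tent_iterate_succ_rightInv_iterate_div hs n hy] at hmem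
  · rwa [le_div_iff₀ hs0, mul_comm, ← critOrbit_three hs]

lemma strictMono_rightInv_iterate_two_mul (hs : 0 < s) (n : ℕ) :
    StrictMono (rightInv s)^[2 * n] := by
  rw [Function.iterate_mul]
  exact ((strictAnti_rightInv hs).comp (strictAnti_rightInv hs)).iterate n

lemma strictAnti_rightInv_iterate_two_mul_add_one (hs : 0 < s) (n : ℕ) :
    StrictAnti (rightInv s)^[2 * n + 1] :=
  (strictMono_rightInv_iterate_two_mul hs n).comp_strictAnti (strictAnti_rightInv hs)

lemma core_subset_closure_of_mem_bargeBrucksDiamond (hs : 1 < s) (h : s ∈ bargeBrucksDiamond) :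
    core s ⊆ closure (cuttingOrbit s) := by
  have hs0 : 0 < s := by linarith
  have h21 := critOrbit_two_lt_critOrbit_one hs
  have h3 : critOrbit s 3 < fixedPt s := by
    rw [← sub_neg, critOrbit_three_sub_fixedPt hs]
    have hsq := two_lt_sq_of_mem_bargeBrucksDiamond hs h
    exact mul_neg_of_neg_of_pos (mul_neg_of_pos_of_neg hs0 (by linarith))
      (sub_pos.2 (crit_lt_fixedPt hs))
  obtain ⟨N, hN⟩ := eventually_atTop.1 ((tendsto_rightInv_iterate hs crit).eventually_const_le h3)
  have hdense : Ioo (critOrbit s 2) (critOrbit s 1) ∩ {crit}ᶜ ⊆ closure (cuttingOrbit s) := by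
    rintro y ⟨hy, hyc⟩
    have hycore := Ioo_subset_Icc_self hy
    rcases lt_or_gt_of_ne hyc with hyc | hyc
    · have hanti := strictAnti_rightInv_iterate_two_mul_add_one hs0 N
      exact mem_closure_cuttingOrbit_of_rightInv_iterate_lt hs h hycore (left_mem_Icc.2 h21.le)
        (hN _ (by omega)) (hanti hyc) (hanti hy.1)
    · have hmono := strictMono_rightInv_iterate_two_mul hs0 N
      exact mem_closure_cuttingOrbit_of_rightInv_iterate_lt hs h hycore (right_mem_Icc.2 h21.le)
        (hN _ (by omega)) (hmono hyc) (hmono hy.2)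
  have hIoo := ((dense_compl_singleton crit).open_subset_closure_inter isOpen_Ioo).trans
    (closure_minimal hdense isClosed_closure)
  rw [core, ← closure_Ioo h21.ne]
  exact closure_minimal hIoo isClosed_closure

end TentMap

theorem propositionA2 (s : ℝ) (hs1 : 1 < s) (hs2 : s ≤ 2) :
    TentMap.core s ⊆
        closure {x : ℝ | ∃ k : ℕ, 1 ≤ k ∧ x = TentMap.critOrbit s (TentMap.cuttingTime s k)} ↔
      s ∈ TentMap.bargeBrucksDiamond :=
  ⟨TentMap.mem_bargeBrucksDiamond_of_core_subset_closure hs1 hs2,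
    TentMap.core_subset_closure_of_mem_bargeBrucksDiamond hs1⟩
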